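/- Let $G=(V,E)$ be a finite undirected multigraph (parallel edges allowed) with $n$ vertices. Let $\lambda$ be the value of a minimum cut of $G$. Let $Y$ be any Gomory–Hu tree of $G$, i.e. a weighted tree on the vertex set $V$ such that for all $s\ne t$ in $V$ every minimum $(s,t)$-cut in $Y$ is also a minimum $(s,t)$-cut in $G$ and has the same value. For $k\ge 1$ let $S_k$ be the sum of the $k$ smallest edge weights of $Y$, and put $$\gamma=\min\Big\{\lambda,\ \tfrac34\cdot\tfrac{S_k}{k}\Big\},\qquad k=2^{-2/3}\,n \text{ rounded down or up to an integer.}$$ Let $q\in[0,1]$ satisfy $q^{\gamma}=\tfrac12$ (such $q$ exists exactly when $\gamma>0$, in particular $G$ is then connected). Let $H\sim G(q)$ be the random multigraph obtained from $G$ by contracting each edge independently with probability $1-q$. Then $|V(H)|\le (2^{-2/3}+n^{-0.1})\,n$ with high probability. That is, for every $c>0$ there is an $n_0$ depending only on $c$ such that for all $G$, $Y$, $q$ as above with $n\ge n_0$ (and for either rounding of $2^{-2/3}n$), $$\Pr_{H\sim G(q)}\Big[\,|V(H)|\le \big(2^{-2/3}+n^{-0.1}\big)\,n\,\Big]\ \ge\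 1-n^{-c}.$$ -/

import Mathlib

namespace Graph

section Contraction

variable {α β : Type*}

/-- The vertex of the contracted graph that contains `x`: all vertices joined to `x` by a walk all
of whose edges lie in `F`. -/
def contractClass (G : Graph α β) (F : Set β) (x : α) : Set α :=
  {y | Relation.ReflTransGen (G.restrict F).Adj x y}

/-- The edges of `G` whose two ends are merged when the edges in `F` are contracted. -/
def mergedEdges (G : Graph α β) (F : Set β) : Set β :=
  {e | ∃ x y, G.IsLink e x y ∧ y ∈ G.contractClass F x}

/-- The multigraph obtained from `G` by contracting the edges in `F`. Its vertices are the
connected components of `(V(G), F)`. Its edges are the edges of `G` between distinct components: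
parallel edges are kept, loops are removed. -/
def contract (G : Graph α β) (F : Set β) : Graph (Set α) β :=
  (G.deleteEdges (G.mergedEdges F)).map (G.contractClass F)

/-- Every set of graphs counts as an event. -/
instance : MeasurableSpace (Graph α β) := ⊤

/-- The distribution `G(q)`: every edge of `G` is contracted independently with probability
`1 - q`. -/
noncomputable def randomContraction (G : Graph α β) (q : unitInterval) :
    MeasureTheory.Measure (Graph (Set α) β) :=
  (ProbabilityTheory.setBernoulli G.edgeSet (unitInterval.symm q)).map G.contract

lemma contract_inter_edgeSet (G : Graph α β) (F : Set β) :
    G.contract (F ∩ G.edgeSet) = G.contract F := by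
  have h : G.contractClass (F ∩ G.edgeSet) = G.contractClass F := by
    funext x
    simp only [contractClass, Graph.restrict_inter_edgeSet]
  simp only [contract, mergedEdges, h]

lemma measurable_contract (G : Graph α β) (hE : G.edgeSet.Finite) :
    Measurable G.contract := by
  intro S _
  have h : G.contract ⁻¹' S =
      ⋃ T ∈ {T : Set β | T ⊆ G.edgeSet ∧ G.contract T ∈ S},
        ⋂ e ∈ G.edgeSet, {F : Set β | e ∈ F ↔ e ∈ T} := by
    ext F
    simp only [Set.mem_preimage, Set.mem_iUnion, Set.mem_iInter, Set.mem_ofPred_eq, exists_prop]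
    constructor
    · intro hF
      refine ⟨F ∩ G.edgeSet, ⟨Set.inter_subset_right, ?_⟩, fun e he => by simp [he]⟩
      rwa [contract_inter_edgeSet]
    · rintro ⟨T, ⟨hT, hTS⟩, hFT⟩
      have : F ∩ G.edgeSet = T := by
        ext e
        exact ⟨fun h => (hFT e h.2).1 h.1, fun h => ⟨(hFT e (hT h)).2 h, hT h⟩⟩
      rwa [← contract_inter_edgeSet, this]
  rw [h]
  refine Set.Finite.measurableSet_biUnion
    (hE.finite_subsets.subset fun T hT => hT.1) fun T _ => ?_
  refine hE.measurableSet_biInter fun e _ => ?_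
  have hm : MeasurableSet {F : Set β | e ∈ F} := measurableSet_setOfPred.2 (measurable_set_mem e)
  by_cases he : e ∈ T
  · simpa [he] using hm
  · have h' : {F : Set β | e ∈ F ↔ e ∈ T} = {F : Set β | e ∈ F}ᶜ := by
      ext F
      simp [he]
    rw [h']
    exact hm.compl

lemma randomContraction_apply (G : Graph α β) (hE : G.edgeSet.Finite) (q : unitInterval)
    (S : Set (Graph (Set α) β)) :
    G.randomContraction q S = ProbabilityTheory.setBernoulli G.edgeSet (unitInterval.symm q)
      {F | G.contract F ∈ S} :=
  MeasureTheory.Measure.map_apply (G.measurable_contract hE) trivial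

end Contraction

section Cuts

variable {α β : Type*}

/-- The number of edges of `G` with exactly one end in `S`. -/
noncomputable def cutValue (G : Graph α β) (S : Set α) : ℕ :=
  {e | ∃ x y, G.IsLink e x y ∧ x ∈ S ∧ y ∉ S}.ncard

/-- The value `λ` of a minimum cut of `G`. -/
noncomputable def minCut (G : Graph α β) : ℕ :=
  sInf {c | ∃ S : Set α, S ⊆ G.vertexSet ∧ S.Nonempty ∧ S ≠ G.vertexSet ∧ c = G.cutValue S}

end Cuts

end Graph

section GomoryHu

/-- `S` is a minimum `(s, t)`-cut for the function `c` that gives the value of each cut. -/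
def IsMinSTCut {V : Type*} (c : Set V → ℕ) (s t : V) (S : Set V) : Prop :=
  s ∈ S ∧ t ∉ S ∧ ∀ T : Set V, s ∈ T → t ∉ T → c S ≤ c T

/-- The total weight of the edges of `Y` with exactly one end in `S`. -/
noncomputable def SimpleGraph.cutWeight {V : Type*} [Finite V] (Y : SimpleGraph V)
    (w : Sym2 V → ℕ) (S : Set V) : ℕ :=
  ∑ e ∈ (Set.toFinite {e ∈ Y.edgeSet | ∃ x y, e = s(x, y) ∧ x ∈ S ∧ y ∉ S}).toFinset, w e

/-- `Y` with edge weights `w` is a Gomory-Hu tree of `G`: a weighted tree on the vertices of `G`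
such that each minimum `(s, t)`-cut in `Y` is a minimum `(s, t)`-cut in `G` of the same value. -/
def Graph.IsGomoryHuTree {α β : Type*} (G : Graph α β) [Finite G.vertexSet]
    (Y : SimpleGraph G.vertexSet) (w : Sym2 G.vertexSet → ℕ) : Prop :=
  Y.IsTree ∧ ∀ s t : G.vertexSet, s ≠ t → ∀ S : Set G.vertexSet,
    IsMinSTCut (Y.cutWeight w) s t S →
      IsMinSTCut (fun T => G.cutValue ((↑) '' T)) s t S ∧
        G.cutValue ((↑) '' S) = Y.cutWeight w S

/-- `S_k`: the sum of the `k` smallest weights among the edges of `Y`. -/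
noncomputable def SimpleGraph.smallestWeightSum {V : Type*} [Finite V] (Y : SimpleGraph V)
    (w : Sym2 V → ℕ) (k : ℕ) : ℕ :=
  ((((Set.toFinite Y.edgeSet).toFinset.val.map w).sort (· ≤ ·)).take k).sum

/-- `γ = min {λ, (3/4) S_k / k}`. -/
noncomputable def Graph.gammaParam {α β : Type*} (G : Graph α β) [Finite G.vertexSet]
    (Y : SimpleGraph G.vertexSet) (w : Sym2 G.vertexSet → ℕ) (k : ℕ) : ℝ :=
  min (G.minCut : ℝ) (3 / 4 * ((Y.smallestWeightSum w k : ℝ) / (k : ℝ)))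

end GomoryHu

/-! ### Russo's formula and exponential moments under drift -/

section Russo

open Finset

variable {β : Type*} [DecidableEq β]

/-! Let m(F) be the number of components of (V, F) minus one. Root the Gomory–Hu tree at a vertex.
Every component other than the root's has a tree edge of its own leaving it, and that edge weighs at
most the cut of the component in G. An edge of G lies in at most two of these cuts, so if m(F) ≥ k,
at least m(F)·S_k/(2k) ≥ (2/3)γ·m(F) edges of G lower m when contracted
(`Graph.IsGomoryHuTree.mul_smallestWeightSum_le`).

Let the probability x that an edge stays uncontracted fall from 1 to q. By Russo's formula, while m
is at least k it shrinks at least as fast as a population of independent individuals dying at rate a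
= 2γ/3 in the time -log x; each of those survives with probability q^a = 2^(-2/3). Hence the
exponential moments of m are at most binomial ones, plus z^k for the range below k (`moment_le`).
Since k is within 1 of 2^(-2/3)·n, Markov's inequality (`tail_le`) makes a deviation of n^0.9
superpolynomially unlikely. -/

lemma Finset.sum_powerset_sum_mem_eq (E : Finset β) (h : Finset β → β → ℝ) :
    ∑ F ∈ E.powerset, ∑ e ∈ F, h (F.erase e) e = ∑ F ∈ E.powerset, ∑ e ∈ E \ F, h F e := by
  rw [Finset.sum_sigma', Finset.sum_sigma']
  refine Finset.sum_bij' (fun x _ => ⟨x.1.erase x.2, x.2⟩) (fun x _ => ⟨insert x.2 x.1, x.2⟩)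
    ?_ ?_ ?_ ?_ ?_
  · rintro ⟨F, e⟩ hx
    simp only [mem_sigma, mem_powerset, mem_sdiff, mem_erase, ne_eq, not_true_eq_false,
      false_and, not_false_eq_true, and_true] at hx ⊢
    exact ⟨(Finset.erase_subset _ _).trans hx.1, hx.1 hx.2⟩
  · rintro ⟨F, e⟩ hx
    simp only [mem_sigma, mem_powerset, mem_sdiff, mem_insert, true_or, and_true] at hx ⊢
    exact Finset.insert_subset hx.2.1 hx.1
  · rintro ⟨F, e⟩ hx
    simp only [mem_sigma] at hx
    simp [Finset.insert_erase hx.2]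
  · rintro ⟨F, e⟩ hx
    simp only [mem_sigma, mem_sdiff] at hx
    simp [Finset.erase_insert hx.2.2]
  · rintro ⟨F, e⟩ _
    rfl

/-- Russo's formula for the mean of `f q F`, where each element of `E` is left out of the random
set `F` independently with probability `q`. -/
lemma hasDerivAt_sum_powerset (E : Finset β) (f : ℝ → Finset β → ℝ) (f' : Finset β → ℝ) (q : ℝ)
    (hf : ∀ F ∈ E.powerset, HasDerivAt (fun x => f x F) (f' F) q) :
    HasDerivAt (fun x => ∑ F ∈ E.powerset, (1 - x) ^ #F * x ^ #(E \ F) * f x F)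
      (∑ F ∈ E.powerset, (1 - q) ^ #F * q ^ (#(E \ F) - 1) * ∑ e ∈ E \ F, (f q F - f q (insert e F))
        + ∑ F ∈ E.powerset, (1 - q) ^ #F * q ^ #(E \ F) * f' F) q := by
  have h1 : HasDerivAt (fun x => ∑ F ∈ E.powerset, (1 - x) ^ #F * x ^ #(E \ F) * f x F)
      (∑ F ∈ E.powerset, (((#F : ℝ) * (1 - q) ^ (#F - 1) * (-1) * q ^ #(E \ F) +
        (1 - q) ^ #F * ((#(E \ F) : ℝ) * q ^ (#(E \ F) - 1))) * f q F +
        (1 - q) ^ #F * q ^ #(E \ F) * f' F)) q := by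
    refine HasDerivAt.fun_sum fun F hF => ?_
    exact ((((hasDerivAt_id q).const_sub 1).pow (#F)).mul (hasDerivAt_pow _ q)).mul (hf F hF)
  convert h1 using 1
  rw [Finset.sum_add_distrib]
  congr 1
  -- Differentiating `(1 - x) ^ #F` gives one term per element of `F`; moving that element out of
  -- `F` matches it with a term from `x ^ #(E \ F)`.
  have h2 : ∑ F ∈ E.powerset, (#F : ℝ) * (1 - q) ^ (#F - 1) * q ^ #(E \ F) * f q F =
      ∑ F ∈ E.powerset, ∑ e ∈ E \ F, (1 - q) ^ #F * q ^ (#(E \ F) - 1) * f q (insert e F) := by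
    rw [← Finset.sum_powerset_sum_mem_eq E
      (fun F e => (1 - q) ^ #F * q ^ (#(E \ F) - 1) * f q (insert e F))]
    refine Finset.sum_congr rfl fun F hF => ?_
    rw [Finset.mem_powerset] at hF
    have : ∀ e ∈ F, (1 - q) ^ #(F.erase e) * q ^ (#(E \ F.erase e) - 1) * f q (insert e (F.erase e))
        = (1 - q) ^ (#F - 1) * q ^ #(E \ F) * f q F := by
      intro e he
      rw [Finset.insert_erase he, Finset.card_erase_of_mem he, Finset.sdiff_erase (hF he),
        Finset.card_insert_of_notMem (by simp [he]), Nat.add_sub_cancel]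
    rw [Finset.sum_congr rfl this, Finset.sum_const, nsmul_eq_mul]
    ring
  have h3 : ∀ F ∈ E.powerset, ((#F : ℝ) * (1 - q) ^ (#F - 1) * (-1) * q ^ #(E \ F) +
        (1 - q) ^ #F * ((#(E \ F) : ℝ) * q ^ (#(E \ F) - 1))) * f q F =
      ∑ e ∈ E \ F, (1 - q) ^ #F * q ^ (#(E \ F) - 1) * f q F
        - (#F : ℝ) * (1 - q) ^ (#F - 1) * q ^ #(E \ F) * f q F := by
    intro F _
    rw [Finset.sum_const, nsmul_eq_mul]
    ring
  rw [Finset.sum_congr rfl h3, Finset.sum_sub_distrib, h2, ← Finset.sum_sub_distrib]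
  refine Finset.sum_congr rfl fun F _ => ?_
  rw [← Finset.sum_sub_distrib, Finset.mul_sum]
  exact Finset.sum_congr rfl fun e _ => by ring

lemma sum_powerset_weight (E : Finset β) (q : ℝ) :
    ∑ F ∈ E.powerset, (1 - q) ^ #F * q ^ #(E \ F) = 1 := by
  have h := Finset.sum_pow_mul_eq_add_pow (1 - q) q E
  rw [sub_add_cancel, one_pow] at h
  exact (Finset.sum_congr rfl fun F hF => by
    rw [Finset.card_sdiff_of_subset (Finset.mem_powerset.1 hF)]).trans h

/-- The pointwise inequality behind `moment_le`. -/
lemma drift_le {E : Finset β} {m : Finset β → ℕ} {k : ℕ} {a u : ℝ} (ha : 0 ≤ a) (hu : 1 ≤ u)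
    {F : Finset β} (hmono : ∀ e ∈ E, m (insert e F) ≤ m F)
    (hdrift : k ≤ m F → a * m F ≤ #{e ∈ E \ F | m (insert e F) < m F}) :
    a * m F * u ^ (m F - 1) * (u - 1) ≤
      ∑ e ∈ E \ F, (u ^ m F - u ^ m (insert e F)) + a * k * u ^ (k - 1) * (u - 1) := by
  have hu0 : 0 ≤ u := zero_le_one.trans hu
  have hu1 : 0 ≤ u - 1 := sub_nonneg.2 hu
  have hnn : ∀ e ∈ E \ F, 0 ≤ u ^ m F - u ^ m (insert e F) := fun e he =>
    sub_nonneg.2 (pow_le_pow_right₀ hu (hmono e (Finset.mem_sdiff.1 he).1))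
  rcases lt_or_ge (m F) k with hk | hk
  -- Below `k` there is no drift; the term that comes from differentiating `u ^ k` pays instead.
  · have h1 : a * m F * u ^ (m F - 1) * (u - 1) ≤ a * k * u ^ (k - 1) * (u - 1) := by
      gcongr
    linarith [Finset.sum_nonneg hnn]
  · have h2 : 0 ≤ a * k * u ^ (k - 1) * (u - 1) := by positivity
    have h3 : ∑ e ∈ E \ F with m (insert e F) < m F, u ^ (m F - 1) * (u - 1) ≤
        ∑ e ∈ E \ F with m (insert e F) < m F, (u ^ m F - u ^ m (insert e F)) := by
      refine Finset.sum_le_sum fun e he => ?_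
      have hlt := (Finset.mem_filter.1 he).2
      obtain ⟨j, hj⟩ : ∃ j, m F = j + 1 := ⟨m F - 1, by omega⟩
      have h4 : u ^ m (insert e F) ≤ u ^ j := pow_le_pow_right₀ hu (by omega)
      rw [hj, Nat.add_sub_cancel, pow_succ]
      linarith
    have h5 : ∑ e ∈ E \ F with m (insert e F) < m F, (u ^ m F - u ^ m (insert e F)) ≤
        ∑ e ∈ E \ F, (u ^ m F - u ^ m (insert e F)) :=
      Finset.sum_le_sum_of_subset_of_nonneg (Finset.filter_subset _ _) fun e he _ => hnn e he
    rw [Finset.sum_const, nsmul_eq_mul] at h3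
    have h6 := mul_le_mul_of_nonneg_right (hdrift hk)
      (mul_nonneg (pow_nonneg hu0 (m F - 1)) hu1)
    linarith

/-- If at least `a * m F` elements lower `m F` whenever `k ≤ m F`, then the exponential moments of
`m` are at most those of a binomial variable with success probability `q ^ a`, up to `z ^ k`. -/
theorem moment_le (E : Finset β) (m : Finset β → ℕ) (k : ℕ) {a q z : ℝ} (ha : 0 ≤ a)
    (hq0 : 0 < q) (hq1 : q ≤ 1) (hz : 1 ≤ z)
    (hmono : ∀ F ⊆ E, ∀ e ∈ E, m (insert e F) ≤ m F)
    (hdrift : ∀ F ⊆ E, k ≤ m F → a * m F ≤ #{e ∈ E \ F | m (insert e F) < m F}) :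
    ∑ F ∈ E.powerset, (1 - q) ^ #F * q ^ #(E \ F) * z ^ m F ≤
      (1 + (z - 1) * q ^ a) ^ m ∅ + z ^ k := by
  -- `u` solves `u' = -(a / x) * (u - 1)` with `u q = z`. For independent individuals surviving with
  -- probability `x ^ a`, the mean of `u x ^ m` would be constant in `x`; here the drift makes `D`
  -- nondecreasing, and `D q ≤ D 1` is the claim.
  set u : ℝ → ℝ := fun x => 1 + (z - 1) * (q / x) ^ a with hu
  set D : ℝ → ℝ := fun x =>
    ∑ F ∈ E.powerset, (1 - x) ^ #F * x ^ #(E \ F) * u x ^ m F - u x ^ k with hD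
  have hu1 : ∀ x, 0 < x → 1 ≤ u x := fun x hx => by
    have : 0 ≤ (z - 1) * (q / x) ^ a := mul_nonneg (sub_nonneg.2 hz) (by positivity)
    simp only [hu]; linarith
  have hu' : ∀ x, 0 < x → HasDerivAt u (-(a / x) * (u x - 1)) x := fun x hx => by
    have h1 : HasDerivAt (fun x : ℝ => q / x) (-q / x ^ 2) x := by
      simpa [div_eq_mul_inv] using (hasDerivAt_inv hx.ne').const_mul q
    have h2 := ((h1.rpow_const (p := a) (Or.inl (by positivity))).const_mul (z - 1)).const_add 1
    refine h2.congr_deriv ?_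
    simp only [hu]
    rw [Real.rpow_sub_one (by positivity)]
    field_simp
    ring
  have hD' : ∀ x, 0 < x → HasDerivAt D
      (∑ F ∈ E.powerset, (1 - x) ^ #F * x ^ (#(E \ F) - 1) *
          ∑ e ∈ E \ F, (u x ^ m F - u x ^ m (insert e F))
        + ∑ F ∈ E.powerset, (1 - x) ^ #F * x ^ #(E \ F) *
          ((m F : ℝ) * u x ^ (m F - 1) * (-(a / x) * (u x - 1)))
        - (k : ℝ) * u x ^ (k - 1) * (-(a / x) * (u x - 1))) x := fun x hx =>
    (hasDerivAt_sum_powerset E (fun x F => u x ^ m F) _ x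
      fun F _ => (hu' x hx).pow (m F)).sub ((hu' x hx).pow k)
  have hmon : MonotoneOn D (Set.Icc q 1) := by
    refine monotoneOn_of_hasDerivWithinAt_nonneg (convex_Icc q 1)
      (fun x hx => (hD' x (hq0.trans_le hx.1)).continuousAt.continuousWithinAt)
      (fun x hx => (hD' x (hq0.trans_le (interior_subset hx).1)).hasDerivWithinAt) ?_
    intro x hx
    have hx0 : 0 < x := hq0.trans_le (interior_subset hx).1
    have hx1 : 0 ≤ 1 - x := sub_nonneg.2 (interior_subset hx).2
    have hw := sum_powerset_weight E x
    have key : ∀ F ∈ E.powerset, (1 - x) ^ #F * x ^ #(E \ F) *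
        ((k : ℝ) * u x ^ (k - 1) * (-(a / x) * (u x - 1))) ≤
        (1 - x) ^ #F * x ^ (#(E \ F) - 1) * ∑ e ∈ E \ F, (u x ^ m F - u x ^ m (insert e F)) +
        (1 - x) ^ #F * x ^ #(E \ F) *
          ((m F : ℝ) * u x ^ (m F - 1) * (-(a / x) * (u x - 1))) := by
      intro F hF
      rw [Finset.mem_powerset] at hF
      have h1 := drift_le ha (hu1 x hx0) (hmono F hF) (hdrift F hF)
      -- The exponent `#(E \ F) - 1` truncates only when `E \ F` is empty, and then the inner sum
      -- vanishes.
      have h2 : x ^ (#(E \ F) - 1) * ∑ e ∈ E \ F, (u x ^ m F - u x ^ m (insert e F)) =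
          x ^ #(E \ F) * ((1 / x) * ∑ e ∈ E \ F, (u x ^ m F - u x ^ m (insert e F))) := by
        rcases (E \ F).eq_empty_or_nonempty with h | h
        · simp [h]
        · obtain ⟨j, hj⟩ : ∃ j, #(E \ F) = j + 1 := ⟨#(E \ F) - 1, by have := h.card_pos; omega⟩
          rw [hj, Nat.add_sub_cancel, pow_succ]
          field_simp
      rw [mul_assoc ((1 - x) ^ #F) (x ^ (#(E \ F) - 1)), h2, ← mul_assoc ((1 - x) ^ #F), ← mul_add]
      refine mul_le_mul_of_nonneg_left ?_ (by positivity)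
      have h3 := mul_le_mul_of_nonneg_left h1 (one_div_nonneg.2 hx0.le)
      have h4 : ∀ b c : ℝ, b * c * (-(a / x) * (u x - 1)) = -(1 / x * (a * b * c * (u x - 1))) :=
        fun b c => by ring
      rw [h4, h4]
      linarith
    have h5 := Finset.sum_le_sum key
    rw [← Finset.sum_mul, hw, one_mul, Finset.sum_add_distrib] at h5
    linarith
  have hfin := hmon ⟨le_rfl, hq1⟩ ⟨hq1, le_rfl⟩ hq1
  have huq : u q = z := by simp [hu, div_self hq0.ne']
  have hu_one : u 1 = 1 + (z - 1) * q ^ a := by simp [hu]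
  have hsum : ∑ F ∈ E.powerset, (1 - (1 : ℝ)) ^ #F * 1 ^ #(E \ F) * u 1 ^ m F = u 1 ^ m ∅ := by
    rw [Finset.sum_eq_single_of_mem ∅ (Finset.empty_mem_powerset E)]
    · simp
    · intro F _ hF
      simp [Finset.card_eq_zero.not.2 hF]
  simp only [hD] at hfin
  rw [hsum, huq, hu_one] at hfin
  have : 0 ≤ (1 + (z - 1) * q ^ a) ^ k := by
    rw [← hu_one]; exact pow_nonneg (zero_le_one.trans (hu1 1 one_pos)) k
  linarith

end Russo

/-! ### Classes of a contraction and their number -/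

namespace Graph

section ContractClasses

variable {α β : Type*} {G : Graph α β} {F F' : Set β} {x y : α} {e : β}

lemma mem_contractClass_self : x ∈ G.contractClass F x := Relation.ReflTransGen.refl

lemma mem_contractClass_symm (h : y ∈ G.contractClass F x) : x ∈ G.contractClass F y :=
  (@Relation.ReflTransGen.stdSymm _ _ ⟨fun _ _ h => Adj.symm h⟩).symm _ _ h

lemma contractClass_eq (h : y ∈ G.contractClass F x) :
    G.contractClass F x = G.contractClass F y := by
  ext z
  exact ⟨fun hz => Relation.ReflTransGen.trans (mem_contractClass_symm h) hz,
    fun hz => Relation.ReflTransGen.trans h hz⟩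

lemma contractClass_mono (h : F ⊆ F') : G.contractClass F x ⊆ G.contractClass F' x :=
  fun _ hy => Relation.ReflTransGen.mono (fun _ _ hab => hab.mono (G.restrict_mono_right h)) _ _ hy

lemma contractClass_subset_vertexSet (hx : x ∈ G.vertexSet) :
    G.contractClass F x ⊆ G.vertexSet := by
  intro y hy
  rcases Relation.ReflTransGen.cases_tail hy with rfl | ⟨z, _, hz⟩
  · exact hx
  · exact (hz.mono restrict_le).right_mem

lemma mem_contractClass_of_isLink (h : G.IsLink e x y) (he : e ∈ F) :
    y ∈ G.contractClass F x :=
  Relation.ReflTransGen.single ⟨e, he, h⟩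

lemma vertexSet_contract (G : Graph α β) (F : Set β) :
    (G.contract F).vertexSet = G.contractClass F '' G.vertexSet := rfl

lemma finite_vertexSet_contract [Finite G.vertexSet] : (G.contract F).vertexSet.Finite :=
  (Set.toFinite G.vertexSet).image _

/-- Provides a surjection from the old classes onto the new ones, so that counts of classes compare
through images. -/
lemma vertexSet_contract_eq_image (h : F ⊆ F') :
    (G.contract F').vertexSet =
      (fun S => ⋃ y ∈ S, G.contractClass F' y) '' (G.contract F).vertexSet := by
  rw [vertexSet_contract, vertexSet_contract, Set.image_image]
  refine Set.image_congr fun x _ => ?_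
  ext z
  simp only [Set.mem_iUnion, exists_prop]
  constructor
  · exact fun hz => ⟨x, mem_contractClass_self, hz⟩
  · rintro ⟨y, hy, hz⟩
    rwa [contractClass_eq (contractClass_mono h hy)]

lemma ncard_contract_anti [Finite G.vertexSet] (h : F ⊆ F') :
    (G.contract F').vertexSet.ncard ≤ (G.contract F).vertexSet.ncard := by
  rw [vertexSet_contract_eq_image h]
  exact Set.ncard_image_le finite_vertexSet_contract

/-- Equal counts would make the surjection between classes injective, yet it sends the classes of
`x` and `y` to the same class. -/
lemma ncard_contract_insert_lt [Finite G.vertexSet] (h : G.IsLink e x y)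
    (hxy : y ∉ G.contractClass F x) :
    (G.contract (insert e F)).vertexSet.ncard < (G.contract F).vertexSet.ncard := by
  have hs : F ⊆ insert e F := Set.subset_insert e F
  refine lt_of_le_of_ne (ncard_contract_anti hs) fun heq => hxy ?_
  rw [vertexSet_contract_eq_image hs, Set.ncard_image_iff finite_vertexSet_contract] at heq
  have hU : ∀ z, ⋃ v ∈ G.contractClass F z, G.contractClass (insert e F) v =
      G.contractClass (insert e F) z := fun z => by
    ext v
    simp only [Set.mem_iUnion, exists_prop]
    constructor
    · rintro ⟨w, hw, hv⟩
      rwa [contractClass_eq (contractClass_mono hs hw)]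
    · exact fun hv => ⟨z, mem_contractClass_self, hv⟩
  have h1 : G.contractClass F x = G.contractClass F y := by
    refine heq ⟨x, h.left_mem, rfl⟩ ⟨y, h.right_mem, rfl⟩ ?_
    simp only [hU]
    exact contractClass_eq (mem_contractClass_of_isLink h (Set.mem_insert e F))
  rw [h1]
  exact mem_contractClass_self

lemma ncard_contract_pos [Finite G.vertexSet] (h : G.vertexSet.Nonempty) :
    0 < (G.contract F).vertexSet.ncard :=
  (Set.ncard_pos finite_vertexSet_contract).2 (h.image _)

lemma ncard_contract_le [Finite G.vertexSet] :
    (G.contract F).vertexSet.ncard ≤ G.vertexSet.ncard :=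
  Set.ncard_image_le (Set.toFinite G.vertexSet)

end ContractClasses

end Graph

/-! ### Gomory–Hu tree edges and the smallest weights -/

section GomoryHu

open Finset

lemma IsMinSTCut.exists_of_finite {V : Type*} [Finite V] (c : Set V → ℕ) {s t : V} (h : s ≠ t) :
    ∃ S, IsMinSTCut c s t S := by
  obtain ⟨S, hS, hmin⟩ := Set.exists_min_image {S : Set V | s ∈ S ∧ t ∉ S} c (Set.toFinite _)
    ⟨{s}, rfl, fun h' => h h'.symm⟩
  exact ⟨S, hS.1, hS.2, fun T hs ht => hmin T ⟨hs, ht⟩⟩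

/-- A minimum `(x, y)`-cut of the tree contains the edge `xy`, and it has the same value as a
minimum `(x, y)`-cut of `G`. -/
lemma Graph.IsGomoryHuTree.le_cutValue {α β : Type*} {G : Graph α β} [Finite G.vertexSet]
    {Y : SimpleGraph G.vertexSet} {w : Sym2 G.vertexSet → ℕ} (hY : G.IsGomoryHuTree Y w)
    {x y : G.vertexSet} (hxy : Y.Adj x y) {P : Set α} (hP : P ⊆ G.vertexSet)
    (hx : (x : α) ∈ P) (hy : (y : α) ∉ P) : w s(x, y) ≤ G.cutValue P := by
  obtain ⟨S, hS⟩ := IsMinSTCut.exists_of_finite (Y.cutWeight w) hxy.ne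
  obtain ⟨hG, heq⟩ := hY.2 x y hxy.ne S hS
  have h1 : w s(x, y) ≤ Y.cutWeight w S :=
    Finset.single_le_sum (f := w) (fun _ _ => Nat.zero_le _)
      (by
        rw [Set.Finite.mem_toFinset]
        exact ⟨hxy, x, y, rfl, hS.1, hS.2.1⟩)
  have h2 := hG.2.2 {v | (v : α) ∈ P} hx hy
  have h3 : ((↑) : G.vertexSet → α) '' {v | (v : α) ∈ P} = P := by
    ext v
    exact ⟨by rintro ⟨v, hv, rfl⟩; exact hv, fun hv => ⟨⟨v, hP hv⟩, hv, rfl⟩⟩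
  simp only [h3] at h2
  omega

/-- Each class of a partition of the vertices of a connected graph, other than the class of the
root, can be given an edge of its own that leaves it. -/
lemma SimpleGraph.Connected.exists_injOn_boundary {V γ : Type*} [Fintype V] [DecidableEq γ]
    {Y : SimpleGraph V} (hY : Y.Connected) (f : V → γ) (r : V) :
    ∃ g : γ → Sym2 V, Set.InjOn g ((univ.image f).erase (f r)) ∧
      ∀ P ∈ (univ.image f).erase (f r), ∃ x y, g P = s(x, y) ∧ Y.Adj x y ∧ f x = P ∧ f y ≠ P := by
  have : Nonempty V := ⟨r⟩
  have hex : ∀ P ∈ (univ.image f).erase (f r), ∃ x y, Y.Adj x y ∧ f x = P ∧ f y ≠ P ∧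
      Y.dist y r < Y.dist x r := by
    intro P hP
    rw [Finset.mem_erase] at hP
    obtain ⟨x₀, -, hx₀⟩ := Finset.mem_image.1 hP.2
    -- For a vertex of the class nearest the root, the next vertex on a shortest path to the root is
    -- nearer still, hence outside the class.
    obtain ⟨x, hx, hmin⟩ := Finset.exists_min_image (univ.filter fun x => f x = P)
      (fun x => Y.dist x r) ⟨x₀, by simp [hx₀]⟩
    have hfx : f x = P := by simpa using hx
    obtain ⟨p, hp⟩ := hY.exists_walk_length_eq_dist x r
    cases p with
    | nil => exact absurd hfx.symm hP.1
    | @cons _ y _ hadj p =>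
      have hlt : Y.dist y r < Y.dist x r := by
        have := SimpleGraph.dist_le p
        rw [SimpleGraph.Walk.length_cons] at hp
        omega
      refine ⟨x, y, hadj, hfx, fun hy => ?_, hlt⟩
      exact hlt.not_ge (hmin y (by simpa using hy))
  choose! x y hadj hfx hfy hd using hex
  refine ⟨fun P => s(x P, y P), ?_, fun P hP => ⟨x P, y P, rfl, hadj P hP, hfx P hP, hfy P hP⟩⟩
  intro P hP Q hQ hPQ
  rw [Finset.mem_coe] at hP hQ
  -- Two classes cannot use one edge in opposite directions, as both directions would lead towards
  -- the root.
  rcases Sym2.eq_iff.1 hPQ with ⟨h, -⟩ | ⟨h1, h2⟩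
  · rw [← hfx P hP, ← hfx Q hQ, h]
  · have h3 := hd P hP
    have h4 := hd Q hQ
    rw [h1, h2] at h3
    omega

lemma List.sum_map_tsub_add_sum_take {L : List ℕ} {a k : ℕ} (hk : k ≤ L.length)
    (h1 : ∀ x ∈ L.take k, x ≤ a) (h2 : ∀ x ∈ L.drop k, a ≤ x) :
    (L.map fun x => a - x).sum + (L.take k).sum = k * a := by
  induction L generalizing k with
  | nil => simp_all
  | cons b L ih =>
    cases k with
    | zero =>
      have : ∀ x ∈ b :: L, a - x = 0 := fun x hx => Nat.sub_eq_zero_of_le (h2 x hx)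
      simp [List.map_congr_left this]
    | succ k =>
      have := ih (k := k) (by simpa using hk)
        (fun x hx => h1 x (by simp [hx])) (fun x hx => h2 x (by simpa using hx))
      have hb : b ≤ a := h1 b (by simp)
      simp only [List.map_cons, List.sum_cons, List.take_succ_cons]
      rw [add_mul]
      omega

/-- The average of the `k` smallest weights is at most the average over any larger set of edges. -/
lemma SimpleGraph.card_mul_smallestWeightSum_le {V : Type*} [Finite V] (Y : SimpleGraph V)
    (w : Sym2 V → ℕ) (k : ℕ) {ι : Type*} (I : Finset ι) (g : ι → Sym2 V)
    (hg : Set.InjOn g I) (hgY : ∀ i ∈ I, g i ∈ Y.edgeSet) (hk : k ≤ #I) :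
    #I * Y.smallestWeightSum w k ≤ k * ∑ i ∈ I, w (g i) := by
  classical
  set T := (Set.toFinite Y.edgeSet).toFinset with hT
  set L := (T.val.map w).sort (· ≤ ·) with hL
  have hS : Y.smallestWeightSum w k = (L.take k).sum := rfl
  have hlen : L.length = #T := by simp [hL]
  have hsub : I.image g ⊆ T := by
    intro e he
    obtain ⟨i, hi, rfl⟩ := Finset.mem_image.1 he
    simpa [hT] using hgY i hi
  have hIT : #I ≤ #T := by
    rw [← Finset.card_image_of_injOn hg]
    exact Finset.card_le_card hsub
  obtain rfl | hk0 := Nat.eq_zero_or_pos k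
  · simp [hS]
  have hsort : L.Pairwise (· ≤ ·) := Multiset.pairwise_sort _ _
  have hkl : k - 1 < L.length := by omega
  -- The `k`-th smallest weight is the threshold: the shortfalls `a - w e`, truncated at 0, total `k
  -- * a - S_k` over the whole tree. The edges of `I` share at most this shortfall among at least
  -- `k` edges, so their average is no smaller than `S_k / k`.
  set a := L[k - 1] with ha
  have h1 : ∀ x ∈ L.take k, x ≤ a := by
    intro x hx
    obtain ⟨i, hi, rfl⟩ := List.mem_iff_getElem.1 hx
    rw [List.getElem_take]
    rw [List.length_take] at hi
    exact hsort.rel_get_of_le (a := ⟨i, by omega⟩) (b := ⟨k - 1, hkl⟩) (by simp; omega)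
  have h2 : ∀ x ∈ L.drop k, a ≤ x := by
    intro x hx
    obtain ⟨i, hi, rfl⟩ := List.mem_iff_getElem.1 hx
    rw [List.getElem_drop]
    rw [List.length_drop] at hi
    exact hsort.rel_get_of_le (a := ⟨k - 1, hkl⟩) (b := ⟨k + i, by omega⟩) (by simp; omega)
  have h3 := List.sum_map_tsub_add_sum_take (by omega) h1 h2
  have h4 : (L.map fun x => a - x).sum = ∑ e ∈ T, (a - w e) := by
    have : (↑L : Multiset ℕ) = T.val.map w := Multiset.sort_eq _ _
    rw [← Multiset.sum_coe, ← Multiset.map_coe, this, Multiset.map_map]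
    rfl
  have h5 : ∑ i ∈ I, (a - w (g i)) ≤ ∑ e ∈ T, (a - w e) := by
    rw [← Finset.sum_image (f := fun e => a - w e) hg]
    exact Finset.sum_le_sum_of_subset hsub
  have h6 : #I * a ≤ ∑ i ∈ I, w (g i) + ∑ i ∈ I, (a - w (g i)) := by
    rw [← Finset.sum_add_distrib, ← smul_eq_mul, ← Finset.sum_const]
    exact Finset.sum_le_sum fun i _ => by omega
  rw [hS]
  rw [h4] at h3
  generalize ∑ e ∈ T, (a - w e) = R at *
  generalize (L.take k).sum = S at *
  generalize ∑ i ∈ I, w (g i) = W at *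
  have h7 : #I * a ≤ W + R := by omega
  zify at *
  have h8 : (0 : ℤ) ≤ R := by positivity
  nlinarith [mul_nonneg (sub_nonneg.2 hk) h8, mul_nonneg hk0.le (sub_nonneg.2 h7)]

end GomoryHu

/-! ### Many edges reduce the number of classes -/

section Drift

open Finset

namespace Graph

variable {α β : Type*} {G : Graph α β} [Finite G.vertexSet]

/-- An edge leaves at most two classes, and contracting it lowers the number of classes. -/
lemma sum_cutValue_le [DecidableEq β] {E : Finset β} (hE : (E : Set β) = G.edgeSet)
    {F : Finset β} (I : Finset (Set α)) (hI : ∀ P ∈ I, P ∈ (G.contract F).vertexSet) :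
    ∑ P ∈ I, G.cutValue P ≤ 2 * #{e ∈ E \ F | (G.contract (insert e F : Finset β)).vertexSet.ncard <
      (G.contract F).vertexSet.ncard} := by
  classical
  set N := {e ∈ E \ F | (G.contract (insert e F : Finset β)).vertexSet.ncard <
      (G.contract F).vertexSet.ncard} with hN
  -- An edge leaving a class is not in `F` and merges two classes when contracted, so every cut lies
  -- inside `N`.
  have h1 : ∀ P ∈ I, G.cutValue P = #{e ∈ N | ∃ x y, G.IsLink e x y ∧ x ∈ P ∧ y ∉ P} := by
    intro P hP
    rw [cutValue, ← Set.ncard_coe_finset]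
    congr 1
    ext e
    simp only [Set.mem_ofPred_eq, Finset.coe_filter]
    refine ⟨fun he => ⟨?_, he⟩, fun he => he.2⟩
    obtain ⟨x, y, h, hx, hy⟩ := he
    obtain ⟨z, hz, rfl⟩ := hI P hP
    rw [contractClass_eq hx] at hy
    rw [hN, Finset.mem_filter, Finset.mem_sdiff, ← Finset.mem_coe, hE, Finset.coe_insert]
    exact ⟨⟨h.edge_mem, fun he => hy (mem_contractClass_of_isLink h he)⟩,
      ncard_contract_insert_lt h hy⟩
  rw [Finset.sum_congr rfl h1]
  simp_rw [Finset.card_filter _ N]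
  rw [Finset.sum_comm, mul_comm, ← smul_eq_mul, ← Finset.sum_const]
  refine Finset.sum_le_sum fun e he => ?_
  rw [← Finset.card_filter]
  have heE : e ∈ G.edgeSet := by
    rw [← hE]
    exact (Finset.mem_sdiff.1 (Finset.mem_filter.1 he).1).1
  obtain ⟨x, y, h⟩ := exists_isLink_of_mem_edgeSet heE
  refine (Finset.card_le_card (t := {G.contractClass F x, G.contractClass F y}) ?_).trans
    Finset.card_le_two
  intro P hP
  obtain ⟨hPI, x', y', h', hx', -⟩ := Finset.mem_filter.1 hP
  obtain ⟨z, hz, rfl⟩ := hI P hPI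
  simp only [Finset.mem_insert, Finset.mem_singleton]
  rw [contractClass_eq hx']
  rcases h'.left_eq_or_eq h with rfl | rfl <;> simp

/-- The root's class gets no tree edge, hence the `- 1`; the factor 2 counts the classes that one
edge can leave. -/
lemma IsGomoryHuTree.mul_smallestWeightSum_le [DecidableEq β] {E : Finset β}
    (hE : (E : Set β) = G.edgeSet) {Y : SimpleGraph G.vertexSet} {w : Sym2 G.vertexSet → ℕ}
    (hY : G.IsGomoryHuTree Y w) (hne : G.vertexSet.Nonempty) {k : ℕ} {F : Finset β}
    (hk : k ≤ (G.contract F).vertexSet.ncard - 1) :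
    ((G.contract F).vertexSet.ncard - 1) * Y.smallestWeightSum w k ≤
      k * (2 * #{e ∈ E \ F | (G.contract (insert e F : Finset β)).vertexSet.ncard <
        (G.contract F).vertexSet.ncard}) := by
  classical
  have := Fintype.ofFinite G.vertexSet
  obtain ⟨r, hr⟩ := hne
  set f : G.vertexSet → Set α := fun v => G.contractClass F v with hf
  obtain ⟨g, hg, hgI⟩ := hY.1.connected.exists_injOn_boundary f ⟨r, hr⟩
  set I := (univ.image f).erase (f ⟨r, hr⟩) with hI
  have himg : ((univ.image f : Finset (Set α)) : Set (Set α)) = (G.contract F).vertexSet := by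
    rw [vertexSet_contract]
    ext P
    simp [hf]
  have hcard : #I = (G.contract F).vertexSet.ncard - 1 := by
    rw [hI, Finset.card_erase_of_mem (by simp), ← himg, Set.ncard_coe_finset]
  have h1 := Y.card_mul_smallestWeightSum_le w k I g hg (fun P hP => by
    obtain ⟨x, y, h, hxy, -⟩ := hgI P hP
    rw [h]
    exact hxy) (hcard ▸ hk)
  have h2 : ∑ P ∈ I, w (g P) ≤ ∑ P ∈ I, G.cutValue P := by
    refine Finset.sum_le_sum fun P hP => ?_
    obtain ⟨x, y, h, hxy, hx, hy⟩ := hgI P hP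
    rw [h]
    rw [← hx] at hy ⊢
    exact hY.le_cutValue hxy (contractClass_subset_vertexSet x.2) mem_contractClass_self
      fun hy' => hy (contractClass_eq hy').symm
  have h3 := sum_cutValue_le hE I fun P hP => by
    rw [← himg]
    exact Finset.mem_of_mem_erase hP
  rw [← hcard]
  exact h1.trans (Nat.mul_le_mul_left k (h2.trans h3))

end Graph

end Drift

/-! ### From the random contraction to finite sums -/

section Measure

open MeasureTheory ProbabilityTheory Measure unitInterval Finset
open scoped ENNReal

lemma ProbabilityTheory.setBernoulli_real_inter_eq {β : Type*} [DecidableEq β] (E T : Finset β)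
    (hT : T ⊆ E) (p : unitInterval) :
    (setBernoulli (E : Set β) p).real {F | F ∩ E = T} = (p : ℝ) ^ #T * (1 - p : ℝ) ^ #(E \ T) := by
  have hset : ((fun f : β → Prop => {i | f i}) ⁻¹' {F : Set β | F ∩ E = T}) =
      Set.pi (E : Set β) fun e => {e ∈ T} := by
    ext f
    simp only [Set.mem_preimage, Set.mem_ofPred_eq, Set.mem_pi, Finset.mem_coe,
      Set.mem_singleton_iff, Set.ext_iff, Set.mem_inter_iff, eq_iff_iff]
    exact ⟨fun h e he => by have := h e; tauto, fun h e => by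
      have := h e; have := @hT e; tauto⟩
  have hp : ∀ e, IsProbabilityMeasure (toNNReal p • dirac (e ∈ (E : Set β)) +
      toNNReal (σ p) • dirac False) := fun e => by infer_instance
  rw [measureReal_def, setBernoulli_apply', hset, infinitePi_pi _ (fun _ _ => .of_discrete)]
  have h1 : ∀ e ∈ E, (toNNReal p • dirac (e ∈ (E : Set β)) + toNNReal (σ p) • dirac False) {e ∈ T} =
      if e ∈ T then (toNNReal p : ℝ≥0∞) else toNNReal (σ p) := by
    intro e he
    by_cases heT : e ∈ T <;> simp [he, heT]
  rw [Finset.prod_congr rfl h1, Finset.prod_ite, Finset.prod_const, Finset.prod_const,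
    Finset.filter_mem_eq_inter, Finset.inter_eq_right.2 hT, Finset.filter_notMem_eq_sdiff]
  simp

/-- The contraction depends only on `F ∩ E`, which takes finitely many values; a union bound over
them suffices. -/
lemma Graph.randomContraction_real_le {α β : Type*} [DecidableEq β] (G : Graph α β)
    {E : Finset β} (hE : (E : Set β) = G.edgeSet) (q : unitInterval) (S : Set (Graph (Set α) β))
    [DecidablePred fun F : Finset β => G.contract (F : Set β) ∈ S] :
    (G.randomContraction q).real S ≤
      ∑ F ∈ E.powerset.filter fun F : Finset β => G.contract (F : Set β) ∈ S,
        (1 - q : ℝ) ^ #F * (q : ℝ) ^ #(E \ F) := by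
  have hsub : {F : Set β | G.contract F ∈ S} ⊆
      ⋃ T ∈ E.powerset.filter fun F : Finset β => G.contract (F : Set β) ∈ S,
        {F : Set β | F ∩ E = (T : Set β)} := by
    intro F hF
    have hfin : (F ∩ E).Finite := E.finite_toSet.inter_of_right F
    simp only [Set.mem_iUnion, exists_prop, Finset.mem_filter, Finset.mem_powerset]
    refine ⟨hfin.toFinset, ⟨fun e he => (by simpa using he : e ∈ F ∧ e ∈ E).2, ?_⟩, by simp⟩
    rw [Set.Finite.coe_toFinset, hE, contract_inter_edgeSet]
    exact hF
  rw [measureReal_def, randomContraction_apply G (hE ▸ E.finite_toSet), ← hE, ← measureReal_def]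
  refine (measureReal_mono hsub (measure_ne_top _ _)).trans
    ((measureReal_biUnion_finset_le _ _).trans (Finset.sum_le_sum fun T hT => ?_))
  rw [setBernoulli_real_inter_eq E T (Finset.mem_powerset.1 (Finset.mem_filter.1 hT).1)]
  simp

lemma Graph.isProbabilityMeasure_randomContraction {α β : Type*} (G : Graph α β)
    (hE : G.edgeSet.Finite) (q : unitInterval) :
    IsProbabilityMeasure (G.randomContraction q) :=
  isProbabilityMeasure_map (G.measurable_contract hE).aemeasurable

end Measure

/-! ### The tail bound -/

section Tail

open Finset

/-- Markov's inequality for `exp (h * m)`, combined with `moment_le`. -/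
lemma tail_le {β : Type*} [DecidableEq β] (E : Finset β) (m : Finset β → ℕ) {k n : ℕ}
    {a q b h s : ℝ} (ha : 0 ≤ a) (hq0 : 0 < q) (hq1 : q ≤ 1) (hb : q ^ a = b) (hb1 : b ≤ 1)
    (hh0 : 0 ≤ h) (hh1 : h ≤ 1) (hn : m ∅ ≤ n) (hk : (k : ℝ) ≤ b * n + 1)
    (hmono : ∀ F ⊆ E, ∀ e ∈ E, m (insert e F) ≤ m F)
    (hdrift : ∀ F ⊆ E, k ≤ m F → a * m F ≤ #{e ∈ E \ F | m (insert e F) < m F})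
    (A : Finset (Finset β)) (hA : A ⊆ E.powerset) (hs : ∀ F ∈ A, b * n + s ≤ m F) :
    ∑ F ∈ A, (1 - q) ^ #F * q ^ #(E \ F) ≤ 2 * Real.exp (h ^ 2 * n - h * s + 1) := by
  have hz : 1 ≤ Real.exp h := Real.one_le_exp hh0
  have hq1' : 0 ≤ 1 - q := sub_nonneg.2 hq1
  have hb0 : 0 ≤ b := hb ▸ Real.rpow_nonneg hq0.le a
  have h1 : Real.exp (h * (b * n + s)) * ∑ F ∈ A, (1 - q) ^ #F * q ^ #(E \ F) ≤
      ∑ F ∈ E.powerset, (1 - q) ^ #F * q ^ #(E \ F) * Real.exp h ^ m F := by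
    rw [Finset.mul_sum]
    refine (Finset.sum_le_sum fun F hF => ?_).trans
      (Finset.sum_le_sum_of_subset_of_nonneg hA fun F _ _ => by positivity)
    rw [mul_comm, ← Real.exp_nat_mul, mul_comm (m F : ℝ)]
    have := hs F hF
    gcongr
  have h2 := h1.trans (moment_le E m k ha hq0 hq1 hz hmono hdrift)
  rw [hb] at h2
  -- The linear term produces the mean `b * n`, the quadratic one the error `h ^ 2 * n`.
  have h3 : Real.exp h - 1 ≤ h + h ^ 2 := by
    have := (abs_le.1 (Real.abs_exp_sub_one_sub_id_le (x := h) (by rwa [abs_of_nonneg hh0]))).2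
    linarith
  have h4 : (1 + (Real.exp h - 1) * b) ^ m ∅ ≤ Real.exp (h * (b * n) + h ^ 2 * n + 1) := by
    have h41 : 1 ≤ 1 + (Real.exp h - 1) * b := by
      have := mul_nonneg (sub_nonneg.2 hz) hb0
      linarith
    calc (1 + (Real.exp h - 1) * b) ^ m ∅ ≤ (1 + (Real.exp h - 1) * b) ^ n :=
          pow_le_pow_right₀ h41 hn
      _ ≤ Real.exp ((Real.exp h - 1) * b) ^ n := by
          gcongr
          linarith [Real.add_one_le_exp ((Real.exp h - 1) * b)]
      _ = Real.exp (n * ((Real.exp h - 1) * b)) := (Real.exp_nat_mul _ _).symm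
      _ ≤ _ := by
          refine Real.exp_le_exp.2 ?_
          have h42 : (n : ℝ) * ((Real.exp h - 1) * b) ≤ n * ((h + h ^ 2) * b) := by gcongr
          have h43 : (n : ℝ) * (h ^ 2 * b) ≤ n * (h ^ 2 * 1) := by gcongr
          linarith
  -- The term `z ^ k` obeys the same bound because `k ≤ b * n + 1` and `h ≤ 1`; hence the `+ 1` in
  -- the exponent and the factor 2.
  have h5 : Real.exp h ^ k ≤ Real.exp (h * (b * n) + h ^ 2 * n + 1) := by
    rw [← Real.exp_nat_mul]
    refine Real.exp_le_exp.2 ?_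
    have h51 := mul_le_mul_of_nonneg_right hk hh0
    have h52 : 0 ≤ h ^ 2 * n := by positivity
    linarith
  have h6 : Real.exp (h * (b * n + s)) * (2 * Real.exp (h ^ 2 * n - h * s + 1)) =
      2 * Real.exp (h * (b * n) + h ^ 2 * n + 1) := by
    rw [mul_left_comm, ← Real.exp_add]
    congr 2
    ring
  refine le_of_mul_le_mul_left ?_ (Real.exp_pos (h * (b * n + s)))
  rw [h6]
  linarith

open Filter Asymptotics in
-- The choice is `h = n ^ (-0.2)` and `s = n ^ 0.9 - 1`, where the `- 1` is the one in `m`. The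
-- exponent is then n^0.6 - n^0.7 + O(1), eventually below -c·log n.
lemma eventually_two_mul_exp_le (c : ℝ) :
    ∀ᶠ x : ℝ in atTop, 2 * Real.exp ((x ^ (-0.2 : ℝ)) ^ 2 * x - x ^ (-0.2 : ℝ) *
      (x ^ (0.9 : ℝ) - 1) + 1) ≤ x ^ (-c) := by
  have h0 : (fun x : ℝ => x ^ (0.6 : ℝ)) =o[atTop] fun x => x ^ (0.7 : ℝ) := by
    refine isLittleO_of_tendsto' ?_ ((tendsto_rpow_neg_atTop (y := 0.1) (by norm_num)).congr' ?_)
    · filter_upwards [eventually_gt_atTop 0] with x hx h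
      exact absurd h (Real.rpow_pos_of_pos hx _).ne'
    · filter_upwards [eventually_gt_atTop 0] with x hx
      rw [← Real.rpow_sub hx]
      norm_num
  have h1 : (fun x : ℝ => c * Real.log x + x ^ (0.6 : ℝ)) =o[atTop] fun x => x ^ (0.7 : ℝ) :=
    ((isLittleO_log_rpow_atTop (by norm_num)).const_mul_left c).add h0
  have h2 : (fun _ : ℝ => (3 : ℝ)) =o[atTop] fun x : ℝ => x ^ (0.7 : ℝ) :=
    isLittleO_const_left.2 (Or.inr
      (tendsto_norm_atTop_atTop.comp (tendsto_rpow_atTop (by norm_num))))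
  filter_upwards [(h1.add h2).bound one_pos, eventually_ge_atTop 1] with x hx hx1
  have hx0 : 0 < x := one_pos.trans_le hx1
  have h3 : (x ^ (-0.2 : ℝ)) ^ 2 * x = x ^ (0.6 : ℝ) := by
    rw [← Real.rpow_natCast, ← Real.rpow_mul hx0.le]
    nth_rw 2 [← Real.rpow_one x]
    rw [← Real.rpow_add hx0]
    norm_num
  have h4 : x ^ (-0.2 : ℝ) * x ^ (0.9 : ℝ) = x ^ (0.7 : ℝ) := by
    rw [← Real.rpow_add hx0]
    norm_num
  have h5 : x ^ (-0.2 : ℝ) ≤ 1 := Real.rpow_le_one_of_one_le_of_nonpos hx1 (by norm_num)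
  have h6 : (2 : ℝ) ≤ Real.exp 1 := by linarith [Real.add_one_le_exp (1 : ℝ)]
  rw [one_mul, Real.norm_of_nonneg (Real.rpow_nonneg hx0.le _)] at hx
  have h7 := (Real.le_norm_self _).trans hx
  calc _ ≤ Real.exp 1 * Real.exp ((x ^ (-0.2 : ℝ)) ^ 2 * x - x ^ (-0.2 : ℝ) *
      (x ^ (0.9 : ℝ) - 1) + 1) := by gcongr
    _ ≤ x ^ (-c) := by
      rw [← Real.exp_add, Real.rpow_def_of_pos hx0 (-c)]
      refine Real.exp_le_exp.2 ?_
      rw [h3, mul_sub, h4]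
      linarith

end Tail

/-! ### The theorem, from drift and tail bound -/

theorem mainTheorem10 :
    ∀ c : ℝ, 0 < c → ∃ n₀ : ℕ,
      ∀ {α β : Type*} (G : Graph α β) [Finite G.vertexSet] [Finite G.edgeSet]
        (n : ℕ), n = G.vertexSet.ncard → n₀ ≤ n →
      ∀ (Y : SimpleGraph G.vertexSet) (w : Sym2 G.vertexSet → ℕ), G.IsGomoryHuTree Y w →
      ∀ k : ℕ, (k = ⌊(2 : ℝ) ^ (-(2 / 3) : ℝ) * n⌋₊ ∨ k = ⌈(2 : ℝ) ^ (-(2 / 3) : ℝ) * n⌉₊) →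
      ∀ q : unitInterval, (q : ℝ) ^ G.gammaParam Y w k = 1 / 2 →
        1 - (n : ℝ) ^ (-c) ≤ (G.randomContraction q).real
          {H | (H.vertexSet.ncard : ℝ) ≤
            ((2 : ℝ) ^ (-(2 / 3) : ℝ) + (n : ℝ) ^ (-(0.1 : ℝ))) * n} := by
  intro c _
  obtain ⟨n₀, hn₀⟩ := Filter.eventually_atTop.1
    (tendsto_natCast_atTop_atTop.eventually (eventually_two_mul_exp_le c))
  refine ⟨max n₀ 1, ?_⟩
  intro α β G _ _ n hn hn₀n Y w hY k hk q hq
  classical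
  have hbound := hn₀ n ((le_max_left _ _).trans hn₀n)
  have hn1 : 1 ≤ n := (le_max_right _ _).trans hn₀n
  have hn1' : (1 : ℝ) ≤ n := by exact_mod_cast hn1
  have hn0 : (0 : ℝ) < n := one_pos.trans_le hn1'
  set b : ℝ := (2 : ℝ) ^ (-(2 / 3) : ℝ) with hb
  set γ := G.gammaParam Y w k with hγ
  have hγ0 : 0 ≤ γ := le_min (by positivity) (by positivity)
  have hγ1 : 0 < γ := by
    rcases hγ0.eq_or_lt with h | h
    · rw [← h, Real.rpow_zero] at hq
      norm_num at hq
    · exact h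
  have hq0 : (0 : ℝ) < q := by
    rcases q.2.1.eq_or_lt with h | h
    · rw [← h, Real.zero_rpow hγ1.ne'] at hq
      norm_num at hq
    · exact h
  have hγS : γ ≤ 3 / 4 * ((Y.smallestWeightSum w k : ℝ) / k) := min_le_right _ _
  -- Division by zero gives 0, so `k = 0` would force `γ ≤ 0`.
  have hk0 : (0 : ℝ) < k := by
    rcases (Nat.cast_nonneg k : (0 : ℝ) ≤ k).eq_or_lt with h | h
    · rw [← h, div_zero, mul_zero] at hγS
      exact absurd hγ1 hγS.not_gt
    · exact h
  -- The rate `a = 2γ/3` turns `q ^ γ = 1/2` into `q ^ a = 2 ^ (-2/3)`.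
  have hqb : (q : ℝ) ^ (2 / 3 * γ) = b := by
    rw [mul_comm, Real.rpow_mul hq0.le, hq, hb, one_div, Real.inv_rpow (by norm_num),
      Real.rpow_neg (by norm_num)]
  have hb0 : 0 ≤ b := by positivity
  have hb1 : b ≤ 1 := Real.rpow_le_one_of_one_le_of_nonpos (by norm_num) (by norm_num)
  have hkb : (k : ℝ) ≤ b * n + 1 := by
    rcases hk with rfl | rfl
    · linarith [Nat.floor_le (mul_nonneg hb0 hn0.le)]
    · exact (Nat.ceil_lt_add_one (mul_nonneg hb0 hn0.le)).le
  have hne : G.vertexSet.Nonempty := Set.nonempty_of_ncard_ne_zero (by omega)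
  have hEfin : G.edgeSet.Finite := Set.toFinite _
  set E := hEfin.toFinset
  have hE : (E : Set β) = G.edgeSet := hEfin.coe_toFinset
  set m : Finset β → ℕ := fun F => (G.contract F).vertexSet.ncard - 1 with hm
  have hpos : ∀ F : Finset β, 0 < (G.contract (F : Set β)).vertexSet.ncard :=
    fun F => Graph.ncard_contract_pos hne
  have hlt : ∀ (F : Finset β) (e : β), m (insert e F) < m F ↔
      (G.contract (insert e F : Finset β)).vertexSet.ncard < (G.contract F).vertexSet.ncard := by
    intro F e
    have := hpos F
    have := hpos (insert e F)
    simp only [hm]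
    omega
  have hmono : ∀ F ⊆ E, ∀ e ∈ E, m (insert e F) ≤ m F := fun F _ e _ =>
    Nat.sub_le_sub_right (Graph.ncard_contract_anti
      (Finset.coe_subset.2 (Finset.subset_insert e F))) 1
  have hdrift : ∀ F ⊆ E, k ≤ m F →
      2 / 3 * γ * m F ≤ (E \ F |>.filter fun e => m (insert e F) < m F).card := by
    intro F _ hkF
    have h1 := hY.mul_smallestWeightSum_le hE hne hkF
    simp_rw [hlt]
    have h2 : (m F : ℝ) * Y.smallestWeightSum w k ≤ k * (2 * ((E \ F |>.filter fun e =>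
      (G.contract (insert e F : Finset β)).vertexSet.ncard <
        (G.contract F).vertexSet.ncard).card : ℝ)) := by exact_mod_cast h1
    -- Here 2/3 · 3/4 = 1/2 absorbs the factor 2 from edges leaving two classes.
    have h3 : 2 / 3 * γ * m F ≤ 2 / 3 * (3 / 4 * ((Y.smallestWeightSum w k : ℝ) / k)) * m F := by
      gcongr
    refine h3.trans ?_
    rw [← mul_le_mul_iff_right₀ hk0]
    field_simp
    linarith
  have hn9 : (n : ℝ) ^ (-(0.1 : ℝ)) * n = (n : ℝ) ^ (0.9 : ℝ) := by
    nth_rw 2 [← Real.rpow_one (n : ℝ)]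
    rw [← Real.rpow_add hn0]
    norm_num
  have hprob := G.isProbabilityMeasure_randomContraction hEfin q
  have hbad : (G.randomContraction q).real {H | (H.vertexSet.ncard : ℝ) ≤
      (b + (n : ℝ) ^ (-(0.1 : ℝ))) * n}ᶜ ≤ (n : ℝ) ^ (-c) := by
    refine (G.randomContraction_real_le hE q _).trans (le_trans ?_ hbound)
    refine tail_le E m (a := 2 / 3 * γ) (by positivity) hq0 q.2.2 hqb hb1 (by positivity)
      (Real.rpow_le_one_of_one_le_of_nonpos hn1' (by norm_num)) ?_ hkb hmono hdrift _
      (Finset.filter_subset _ _) fun F hF => ?_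
    · exact (Nat.sub_le _ _).trans (hn ▸ Graph.ncard_contract_le)
    · have h1 := (Finset.mem_filter.1 hF).2
      rw [Set.mem_compl_iff, Set.mem_ofPred_eq, not_le, add_mul, hn9] at h1
      have h2 : (m F : ℝ) = (G.contract (F : Set β)).vertexSet.ncard - 1 := by
        rw [hm, Nat.cast_sub (hpos F), Nat.cast_one]
      rw [h2]
      linarith
  have := MeasureTheory.probReal_compl_eq_one_sub (μ := G.randomContraction q)
    (s := {H | (H.vertexSet.ncard : ℝ) ≤
      (b + (n : ℝ) ^ (-(0.1 : ℝ))) * n}) trivial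
  linarith
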